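/- Let $\varphi\in C^2(\mathbb R^2,\mathbb R)$, let $\psi\in C^1(\mathbb R,\mathbb R)$ be strictly increasing with $\psi(0)=0$ and $\sup_{s\in\mathbb R}\psi'(s)<\infty$, and let $k_n>0$. Put $\mathcal P=\{\varphi=0\}$ (the desired path), $\bar n=\nabla\varphi$, $\mathcal C_0=\{\nabla\varphi=0\}$ (the set of critical points), $e=\psi\circ\varphi$, let $H$ be the Hessian matrix of $\varphi$, and let $$\bar v=E\bar n-k_n\,e\,\bar n,\qquad E=\begin{bmatrix}0&1\\-1&0\end{bmatrix}.$$ Assume (with the convention $\inf\emptyset=+\infty$, also in the distance to an empty set) that 1. for every $\varkappa>0$, $\ \inf\{|e(\bar r)|:\operatorname{dist}(\bar r,\mathcal P)\ge\varkappa\}>0$; 2. $\operatorname{dist}(\mathcal C_0,\mathcal P)>0$; 3. for every $\varkappa>0$, $\ \inf\{|\bar n(\bar r)|:\operatorname{dist}(\bar r,\mathcal C_0)\ge\varkappa\}>0$. Suppose that $\mathcal C_0$ is finite and that for every $\bar\xi_*\in\mathcal C_0$ the symmetric matrix $e(\bar\xi_*)H(\bar\xi_*)$ has a negative eigenvalue.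 Then for Lebesgue-almost every initial condition $\bar\xi_0\in\mathbb R^2$ the maximally prolonged solution $\bar\xi:[0,t_*)\to\mathbb R^2$, $0<t_*\le\infty$, of $\dot{\bar\xi}=\bar v(\bar\xi)$, $\bar\xi(0)=\bar\xi_0$, exists and converges to $\mathcal P$, that is, $\operatorname{dist}(\bar\xi(t),\mathcal P)\to0$ as $t\to t_*$ (where $t_*$ may be finite). If, moreover, the matrix $e(\bar\xi_*)H(\bar\xi_*)$ is negative definite for every $\bar\xi_*\in\mathcal C_0$, then this holds for every $\bar\xi_0\in\mathbb R^2\setminus\mathcal C_0$. -/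

import Mathlib

open scoped Gradient

noncomputable section

namespace GuidingField

/-- The Euclidean plane. -/
abbrev Plane : Type := EuclideanSpace ℝ (Fin 2)

/-- The desired path: the zero set of `φ`. -/
def path (φ : Plane → ℝ) : Set Plane := {r | φ r = 0}

/-- The set of critical points of `φ`. -/
def criticalSet (φ : Plane → ℝ) : Set Plane := {r | ∇ φ r = 0}

/-- The tracking error `e = ψ ∘ φ`. -/
def trackingError (φ : Plane → ℝ) (ψ : ℝ → ℝ) (r : Plane) : ℝ := ψ (φ r)

/-- The matrix `E` of the rotation by `-π/2`. -/
def rotE : Matrix (Fin 2) (Fin 2) ℝ := !![0, 1; -1, 0]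

/-- The tangent vector `τ = E n`, where `n = ∇ φ`. -/
def tangent (φ : Plane → ℝ) (r : Plane) : Plane := Matrix.toEuclideanLin rotE (∇ φ r)

/-- The vector field `v = τ - k e n`. -/
def field (φ : Plane → ℝ) (ψ : ℝ → ℝ) (k : ℝ) (r : Plane) : Plane :=
  tangent φ r - (k * trackingError φ ψ r) • ∇ φ r

/-- The Hessian matrix of `φ` : its entries are the second partial derivatives `∂ᵢ ∂ⱼ φ`. -/
def hessian (φ : Plane → ℝ) (r : Plane) : Matrix (Fin 2) (Fin 2) ℝ :=
  Matrix.of fun i j =>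
    fderiv ℝ (fun s => fderiv ℝ φ s (EuclideanSpace.single j 1)) r (EuclideanSpace.single i 1)

/-- The real square matrix `M` has a negative (real) eigenvalue. -/
def HasNegativeEigenvalue (M : Matrix (Fin 2) (Fin 2) ℝ) : Prop :=
  ∃ μ : ℝ, μ < 0 ∧ Module.End.HasEigenvalue (Matrix.toLin' M) μ

/-- `inf {|f r| : dist (r, S) ≥ κ} > 0` for every `κ > 0`; the infimum of the empty set is `+∞`,
both here and in the distance to an empty set `S`. -/
def BoundedAwayFromZeroOff {F : Type*} [NormedAddCommGroup F] (f : Plane → F)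
    (S : Set Plane) : Prop :=
  ∀ κ : ℝ, 0 < κ → ∃ c : ℝ, 0 < c ∧
    ∀ r : Plane, ENNReal.ofReal κ ≤ Metric.infEDist r S → c ≤ ‖f r‖

/-- The distance between the sets `A` and `B` is positive. -/
def PositiveDistance (A B : Set Plane) : Prop :=
  ∃ δ : ℝ, 0 < δ ∧ ∀ a ∈ A, ∀ b ∈ B, δ ≤ dist a b

/-- The interval `[0, T)`, where `T` may be `+∞`. -/
def timeInterval (T : EReal) : Set ℝ := {t : ℝ | 0 ≤ t ∧ (t : EReal) < T}

/-- `ξ` solves the differential equation `ξ' = v ξ` on `[0, T)`; the derivative at `0` is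
one-sided, and the values of `ξ` outside `[0, T)` are irrelevant. -/
def IsSolution (v : Plane → Plane) (T : EReal) (ξ : ℝ → Plane) : Prop :=
  ∀ t ∈ timeInterval T, HasDerivWithinAt ξ (v (ξ t)) (timeInterval T) t

/-- `ξ` on `[0, T)`, with `0 < T ≤ +∞`, is a maximally prolonged solution of `ξ' = v ξ` : it has no
extension to a solution on a longer interval `[0, T')`. -/
def IsMaximalSolution (v : Plane → Plane) (T : EReal) (ξ : ℝ → Plane) : Prop :=
  0 < T ∧ IsSolution v T ξ ∧
    ∀ (T' : EReal) (η : ℝ → Plane), IsSolution v T' η → Set.EqOn η ξ (timeInterval T) → T' ≤ T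

/-- `dist (ξ t, S) → 0` as `t → T` from the left, where `T` may be `+∞`. -/
def ConvergesTo (ξ : ℝ → Plane) (T : EReal) (S : Set Plane) : Prop :=
  ∀ ε : ℝ, 0 < ε → ∃ t₀ ∈ timeInterval T, ∀ t ∈ timeInterval T, t₀ ≤ t →
    Metric.infEDist (ξ t) S < ENNReal.ofReal ε

/-- The equation `ξ' = v ξ` has a maximally prolonged solution that starts at `ξ₀`, and every
such solution converges to `S`. -/
def MaximalSolutionConverges (v : Plane → Plane) (S : Set Plane) (ξ₀ : Plane) : Prop :=
  (∃ (T : EReal) (ξ : ℝ → Plane), IsMaximalSolution v T ξ ∧ ξ 0 = ξ₀) ∧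
    ∀ (T : EReal) (ξ : ℝ → Plane), IsMaximalSolution v T ξ → ξ 0 = ξ₀ → ConvergesTo ξ T S

end GuidingField

end

/-!
Along a solution `ξ` of `ξ' = v ξ` the function `φ` satisfies `φ' = -k ψ(φ) ‖∇ φ‖ ^ 2`, so that
`|φ|` decreases. If its limit is zero, then so is the limit of the error, and the solution converges
to the path. Otherwise `|φ|` stays away from zero and from infinity, and a multiple of `φ ^ 2` is a
nonnegative function that decreases at least at the rate `‖v‖ ^ 2` (`exists_isEnergy`). Then the
solution has finite length on finite intervals, so a maximal one is global, and it finally remains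
near a single critical point, because travelling a distance away from the critical points
consumes a fixed amount of energy (`IsEnergy.exists_forall_norm_sub_lt`).

It remains to see that few solutions are trapped near a critical point `c`. The derivative of `v`
there is `(E - k e) H`. In an orthonormal eigenframe of `-e H`, with eigenvalues `ρ > 0` and `ν`,
some quadratic form `Q = ρ x ^ 2 + γ y ^ 2` grows along the linearized equation at a rate that
dominates `Q` itself (`exists_growing_form`): this is `-⟨e H w, w⟩` if `ν > 0`, and has a smaller
coefficient `γ < ν` otherwise. As `v` is strictly differentiable at `c`, the form `Q` grows
exponentially along the difference of any two solutions that stay near `c`, unless it is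
nonpositive there (`exists_forall_form_nonpos`). Hence the difference of two trapped solutions
satisfies `Q ≤ 0`, and is bounded by a multiple of its coordinate `y`; it vanishes if `e H` is
negative definite, in which case only the equilibrium is trapped. By Gronwall's inequality backwards in time, the initial values
of the solutions that are trapped after a given time, and in a given ball before, form a set with an
antilipschitz map to the line (`volume_trappedSet`). Such a set has Hausdorff dimension at most one
and is therefore a null set, and countably many of them cover the exceptional initial values.
-/

namespace GuidingField

open Set Filter Topology Metric
open scoped NNReal

/-! ### Solutions of autonomous differential equations in the plane -/

lemma mem_timeInterval_of_le {T : EReal} {s t : ℝ} (ht : t ∈ timeInterval T) (hs : 0 ≤ s)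
    (hst : s ≤ t) : s ∈ timeInterval T :=
  ⟨hs, lt_of_le_of_lt (by exact_mod_cast hst) ht.2⟩

lemma timeInterval_top : timeInterval ⊤ = Ici 0 := by
  ext t; simp [timeInterval, EReal.coe_lt_top]

lemma timeInterval_coe (b : ℝ) : timeInterval (b : EReal) = Ico 0 b := by
  ext t; simp [timeInterval]

lemma setOf_coe_lt_mem_nhds {T : EReal} {t : ℝ} (ht : (t : EReal) < T) :
    {s : ℝ | (s : EReal) < T} ∈ 𝓝 t :=
  (isOpen_Iio.preimage continuous_coe_real_ereal).mem_nhds ht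

section

variable {v : Plane → Plane} {T T' : EReal} {ξ η : ℝ → Plane}

lemma IsSolution.hasDerivWithinAt_Ici (h : IsSolution v T ξ) {t : ℝ} (ht : t ∈ timeInterval T) :
    HasDerivWithinAt ξ (v (ξ t)) (Ici t) t := by
  refine (h t ht).mono_of_mem_nhdsWithin ?_
  filter_upwards [self_mem_nhdsWithin, mem_nhdsWithin_of_mem_nhds (setOf_coe_lt_mem_nhds ht.2)]
    with s hs hs'
  exact ⟨ht.1.trans hs, hs'⟩

lemma IsSolution.hasDerivAt (h : IsSolution v T ξ) {t : ℝ} (ht : t ∈ timeInterval T)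
    (h0 : 0 < t) : HasDerivAt ξ (v (ξ t)) t := by
  refine (h t ht).hasDerivAt ?_
  filter_upwards [Ioi_mem_nhds h0, setOf_coe_lt_mem_nhds ht.2] with s hs hs'
  exact ⟨le_of_lt hs, hs'⟩

lemma IsSolution.continuousOn (h : IsSolution v T ξ) : ContinuousOn ξ (timeInterval T) :=
  fun t ht => (h t ht).continuousWithinAt

lemma Icc_subset_timeInterval {a b : ℝ} (ha : 0 ≤ a) (hb : b ∈ timeInterval T) :
    Icc a b ⊆ timeInterval T :=
  fun _ hs => mem_timeInterval_of_le hb (ha.trans hs.1) hs.2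

lemma mul_exp_le_of_mul_le_deriv {q q' : ℝ → ℝ} {κ a b : ℝ} (hab : a ≤ b)
    (hq : ContinuousOn q (Icc a b)) (hd : ∀ t ∈ Ioo a b, HasDerivAt q (q' t) t)
    (h : ∀ t ∈ Ioo a b, κ * q t ≤ q' t) : q a * Real.exp (κ * (b - a)) ≤ q b := by
  have hD : ∀ t ∈ Ioo a b, HasDerivAt (fun t => q t * Real.exp (-κ * t))
      (q' t * Real.exp (-κ * t) + q t * (Real.exp (-κ * t) * (-κ))) t := fun t ht => by
    have h1 : HasDerivAt (fun t : ℝ => -κ * t) (-κ) t := by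
      simpa using (hasDerivAt_id t).const_mul (-κ)
    exact (hd t ht).mul h1.exp
  have hm : MonotoneOn (fun t => q t * Real.exp (-κ * t)) (Icc a b) := by
    refine monotoneOn_of_deriv_nonneg (convex_Icc a b) (hq.mul (by fun_prop)) ?_ ?_
    · rw [interior_Icc]
      exact fun t ht => (hD t ht).differentiableAt.differentiableWithinAt
    · rw [interior_Icc]
      intro t ht
      rw [(hD t ht).deriv]
      have := mul_nonneg (sub_nonneg.2 (h t ht)) (Real.exp_pos (-κ * t)).le
      linarith
  have h2 := mul_le_mul_of_nonneg_right
    (hm (left_mem_Icc.2 hab) (right_mem_Icc.2 hab) hab) (Real.exp_pos (κ * b)).le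
  have e1 : q a * Real.exp (-κ * a) * Real.exp (κ * b) = q a * Real.exp (κ * (b - a)) := by
    rw [mul_assoc, ← Real.exp_add]; ring_nf
  have e2 : q b * Real.exp (-κ * b) * Real.exp (κ * b) = q b := by
    rw [mul_assoc, ← Real.exp_add]; simp
  simpa only [e1, e2] using h2

/-- Gronwall's inequality for the squared distance of two solutions, in both time directions. -/
lemma IsSolution.sq_norm_sub_bounds (hξ : IsSolution v T ξ) (hη : IsSolution v T' η)
    {S : Set Plane} {L : ℝ≥0} (hL : LipschitzOnWith L v S) {a b : ℝ} (ha : 0 ≤ a) (hab : a ≤ b)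
    (hb : b ∈ timeInterval T) (hb' : b ∈ timeInterval T')
    (hξS : ∀ t ∈ Icc a b, ξ t ∈ S) (hηS : ∀ t ∈ Icc a b, η t ∈ S) :
    ‖ξ a - η a‖ ^ 2 * Real.exp (-2 * L * (b - a)) ≤ ‖ξ b - η b‖ ^ 2 ∧
      ‖ξ b - η b‖ ^ 2 ≤ ‖ξ a - η a‖ ^ 2 * Real.exp (2 * L * (b - a)) := by
  have hsub := Icc_subset_timeInterval ha hb
  have hsub' := Icc_subset_timeInterval ha hb'
  have hc : ContinuousOn (fun t => ‖ξ t - η t‖ ^ 2) (Icc a b) :=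
    ((hξ.continuousOn.mono hsub).sub (hη.continuousOn.mono hsub')).norm.pow 2
  have hd : ∀ t ∈ Ioo a b, HasDerivAt (fun t => ‖ξ t - η t‖ ^ 2)
      (2 * inner ℝ (ξ t - η t) (v (ξ t) - v (η t))) t := fun t ht => by
    have h0 : 0 < t := ha.trans_lt ht.1
    have ht' := Ioo_subset_Icc_self ht
    exact ((hξ.hasDerivAt (hsub ht') h0).sub (hη.hasDerivAt (hsub' ht') h0)).norm_sq
  have hbd : ∀ t ∈ Ioo a b, |inner ℝ (ξ t - η t) (v (ξ t) - v (η t))| ≤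
      L * ‖ξ t - η t‖ ^ 2 := fun t ht => by
    have ht' := Ioo_subset_Icc_self ht
    have h1 := hL.norm_sub_le (hξS t ht') (hηS t ht')
    have h2 := abs_real_inner_le_norm (ξ t - η t) (v (ξ t) - v (η t))
    nlinarith [norm_nonneg (ξ t - η t)]
  constructor
  · refine mul_exp_le_of_mul_le_deriv (q := fun t => ‖ξ t - η t‖ ^ 2) hab hc hd fun t ht => ?_
    have := neg_le_of_abs_le (hbd t ht)
    linarith
  · have h := mul_exp_le_of_mul_le_deriv (q := fun t => -‖ξ t - η t‖ ^ 2) (κ := 2 * L) hab hc.neg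
      (fun t ht => (hd t ht).neg) fun t ht => by
        have := le_of_abs_le (hbd t ht)
        linarith
    linarith

lemma exists_lipschitzOnWith_closedBall (hv : ContDiff ℝ 1 v) (R : ℝ) :
    ∃ L : ℝ≥0, LipschitzOnWith L v (closedBall 0 R) :=
  hv.locallyLipschitz.locallyLipschitzOn.exists_lipschitzOnWith_of_compact
    (isCompact_closedBall _ _)

lemma IsSolution.exists_norm_le (hξ : IsSolution v T ξ) {b : ℝ} (hb : b ∈ timeInterval T) :
    ∃ R : ℝ, ∀ t ∈ Icc 0 b, ‖ξ t‖ ≤ R :=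
  isCompact_Icc.exists_bound_of_continuousOn
    (hξ.continuousOn.mono (Icc_subset_timeInterval le_rfl hb))

lemma IsSolution.exists_bounds (hv : ContDiff ℝ 1 v) (hξ : IsSolution v T ξ)
    (hη : IsSolution v T' η) {t : ℝ} (ht : t ∈ timeInterval T) (ht' : t ∈ timeInterval T') :
    ∃ C : ℝ, ‖ξ 0 - η 0‖ ^ 2 ≤ C * ‖ξ t - η t‖ ^ 2 ∧ ‖ξ t - η t‖ ^ 2 ≤ C * ‖ξ 0 - η 0‖ ^ 2 := by
  obtain ⟨R, hR⟩ := hξ.exists_norm_le ht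
  obtain ⟨R', hR'⟩ := hη.exists_norm_le ht'
  obtain ⟨L, hL⟩ := exists_lipschitzOnWith_closedBall hv (max R R')
  obtain ⟨h1, h2⟩ := hξ.sq_norm_sub_bounds hη hL le_rfl ht.1 ht ht'
    (fun s hs => by simpa using Or.inl (hR s hs)) (fun s hs => by simpa using Or.inr (hR' s hs))
  refine ⟨Real.exp (2 * L * (t - 0)), ?_, by linarith⟩
  have h3 := mul_le_mul_of_nonneg_left h1 (Real.exp_pos (2 * L * (t - 0))).le
  have e : Real.exp (2 * L * (t - 0)) * (‖ξ 0 - η 0‖ ^ 2 * Real.exp (-2 * L * (t - 0))) =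
      ‖ξ 0 - η 0‖ ^ 2 := by
    rw [mul_left_comm, ← Real.exp_add]; simp
  linarith

lemma IsSolution.eq_of_eq_zero (hv : ContDiff ℝ 1 v) (hξ : IsSolution v T ξ)
    (hη : IsSolution v T' η) (h0 : ξ 0 = η 0) {t : ℝ} (ht : t ∈ timeInterval T)
    (ht' : t ∈ timeInterval T') : ξ t = η t := by
  obtain ⟨C, -, h⟩ := hξ.exists_bounds hv hη ht ht'
  rw [h0, sub_self, norm_zero] at h
  rw [← sub_eq_zero, ← norm_le_zero_iff]
  nlinarith [norm_nonneg (ξ t - η t)]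

lemma IsSolution.eq_zero_of_eq (hv : ContDiff ℝ 1 v) (hξ : IsSolution v T ξ)
    (hη : IsSolution v T' η) {t : ℝ} (ht : t ∈ timeInterval T)
    (ht' : t ∈ timeInterval T') (h : ξ t = η t) : ξ 0 = η 0 := by
  obtain ⟨C, h', -⟩ := hξ.exists_bounds hv hη ht ht'
  rw [h, sub_self, norm_zero] at h'
  rw [← sub_eq_zero, ← norm_le_zero_iff]
  nlinarith [norm_nonneg (ξ 0 - η 0)]

lemma exists_isSolution (hv : ContDiff ℝ 1 v) (x : Plane) :
    ∃ (ε : ℝ) (ξ : ℝ → Plane), 0 < ε ∧ IsSolution v ε ξ ∧ ξ 0 = x := by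
  obtain ⟨α, h0, ε, hε, hα⟩ :=
    hv.contDiffAt.exists_forall_mem_closedBall_exists_eq_forall_mem_Ioo_hasDerivAt₀ (x₀ := x) 0
  refine ⟨ε, α, hε, fun t ht => ?_, h0⟩
  rw [timeInterval_coe] at ht
  exact (hα t ⟨by linarith [ht.1], by linarith [ht.2]⟩).hasDerivWithinAt

/-- The maximal solution is glued from all solutions with the given initial value, which agree
wherever two of them are defined. -/
lemma exists_isMaximalSolution (hv : ContDiff ℝ 1 v) (x : Plane) :
    ∃ (T : EReal) (ξ : ℝ → Plane), IsMaximalSolution v T ξ ∧ ξ 0 = x := by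
  classical
  let A : Set EReal := {T | ∃ η : ℝ → Plane, IsSolution v T η ∧ η 0 = x}
  have key : ∀ t : ℝ, ∃ y : Plane, ∀ T η, IsSolution v T η → η 0 = x → t ∈ timeInterval T →
      η t = y := by
    intro t
    by_cases h : ∃ T η, IsSolution v T η ∧ η 0 = x ∧ t ∈ timeInterval T
    · obtain ⟨T, η, h1, h2, h3⟩ := h
      exact ⟨η t, fun T' η' h1' h2' h3' =>
        h1'.eq_of_eq_zero hv h1 (h2'.trans h2.symm) h3' h3⟩
    · push Not at h
      exact ⟨0, fun T η h1 h2 h3 => absurd h3 (h T η h1 h2)⟩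
  choose ξ hξ using key
  obtain ⟨ε, α, hε, hα, hα0⟩ := exists_isSolution hv x
  have hεA : (ε : EReal) ≤ sSup A := le_sSup ⟨α, hα, hα0⟩
  have hpos : (0 : EReal) < sSup A := lt_of_lt_of_le (by exact_mod_cast hε) hεA
  have h0 : ξ 0 = x := by
    rw [← hξ 0 ε α hα hα0 ⟨le_rfl, by exact_mod_cast hε⟩, hα0]
  refine ⟨sSup A, ξ, ⟨hpos, fun t ht => ?_, fun T' η hη hηξ => ?_⟩, h0⟩
  · obtain ⟨T, ⟨η, hη, hη0⟩, htT⟩ := lt_sSup_iff.1 ht.2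
    have htT' : t ∈ timeInterval T := ⟨ht.1, htT⟩
    have hev : ξ =ᶠ[𝓝[timeInterval (sSup A)] t] η := by
      filter_upwards [self_mem_nhdsWithin,
        mem_nhdsWithin_of_mem_nhds (setOf_coe_lt_mem_nhds htT)] with s hs hs'
      exact (hξ s T η hη hη0 ⟨hs.1, hs'⟩).symm
    have hte : ξ t = η t := (hξ t T η hη hη0 htT').symm
    rw [hte]
    refine HasDerivWithinAt.congr_of_eventuallyEq ?_ hev hte
    refine (hη t htT').mono_of_mem_nhdsWithin ?_
    filter_upwards [self_mem_nhdsWithin,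
      mem_nhdsWithin_of_mem_nhds (setOf_coe_lt_mem_nhds htT)] with s hs hs'
    exact ⟨hs.1, hs'⟩
  · exact le_sSup ⟨η, hη, by rw [hηξ ⟨le_rfl, hpos⟩, h0]⟩

/-- A maximal solution on a finite interval `[0, b)` has no limit at `b`: it could be continued by
the solution that starts at the limit. -/
lemma IsMaximalSolution.not_tendsto (hv : ContDiff ℝ 1 v) {b : ℝ}
    (h : IsMaximalSolution v b ξ) (x : Plane) : ¬ Tendsto ξ (𝓝[<] b) (𝓝 x) := by
  classical
  intro hx
  obtain ⟨hb, hξ, hmax⟩ := h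
  have hb0 : 0 < b := by exact_mod_cast hb
  rw [IsSolution, timeInterval_coe] at hξ
  obtain ⟨α, hα0, ε, hε, hα⟩ :=
    hv.contDiffAt.exists_forall_mem_closedBall_exists_eq_forall_mem_Ioo_hasDerivAt₀ (x₀ := x) b
  let ζ : ℝ → Plane := fun t => if t < b then ξ t else α t
  have hζl : ∀ t < b, ζ t = ξ t := fun t ht => if_pos ht
  have hζr : ∀ t, b ≤ t → ζ t = α t := fun t ht => if_neg (not_lt.2 ht)
  have hleft : ∀ t ∈ Ioo 0 b, HasDerivAt ζ (v (ζ t)) t := fun t ht => by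
    have h1 : HasDerivAt ξ (v (ξ t)) t :=
      (hξ t ⟨ht.1.le, ht.2⟩).hasDerivAt (Ico_mem_nhds ht.1 ht.2)
    rw [hζl t ht.2]
    exact h1.congr_of_eventuallyEq
      (by filter_upwards [Iio_mem_nhds ht.2] with s hs using hζl s hs)
  have hζx : Tendsto ζ (𝓝[<] b) (𝓝 x) :=
    hx.congr' (by filter_upwards [self_mem_nhdsWithin] with s hs using (hζl s hs).symm)
  have hζb : ζ b = x := by rw [hζr b le_rfl, hα0]
  have hmid : HasDerivAt ζ (v (ζ b)) b := by
    have h1 : HasDerivWithinAt ζ (v (ζ b)) (Iic b) b := by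
      refine hasDerivWithinAt_Iic_of_tendsto_deriv (s := Ioo 0 b)
        (fun t ht => (hleft t ht).differentiableAt.differentiableWithinAt) ?_
        (Ioo_mem_nhdsLT hb0) ?_
      · rw [ContinuousWithinAt, hζb]
        exact hζx.mono_left (nhdsWithin_mono _ Ioo_subset_Iio_self)
      · rw [hζb]
        refine ((hv.continuous.tendsto x).comp hζx).congr' ?_
        filter_upwards [Ioo_mem_nhdsLT hb0] with t ht using (hleft t ht).deriv.symm
    have h2 : HasDerivWithinAt ζ (v (ζ b)) (Ici b) b := by
      have h3 := (hα b ⟨by linarith, by linarith⟩).hasDerivWithinAt (s := Ici b)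
      rw [hζr b le_rfl]
      exact h3.congr (fun s hs => hζr s hs) (hζr b le_rfl)
    have h3 := h1.union h2
    rwa [Iic_union_Ici, hasDerivWithinAt_univ] at h3
  have hsol : IsSolution v ((b + ε : ℝ) : EReal) ζ := by
    rw [IsSolution, timeInterval_coe]
    intro t ht
    rcases lt_trichotomy t b with htb | rfl | htb
    · rcases ht.1.eq_or_lt with rfl | h0
      · have h1 := hξ 0 ⟨le_rfl, hb0⟩
        rw [hζl 0 hb0]
        refine HasDerivWithinAt.congr_of_eventuallyEq (f := ξ) ?_ ?_ (hζl 0 hb0)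
        · refine h1.mono_of_mem_nhdsWithin ?_
          filter_upwards [self_mem_nhdsWithin,
            mem_nhdsWithin_of_mem_nhds (Iio_mem_nhds hb0)] with s hs hs' using ⟨hs.1, hs'⟩
        · filter_upwards [mem_nhdsWithin_of_mem_nhds (Iio_mem_nhds hb0)] with s hs using hζl s hs
      · exact (hleft t ⟨h0, htb⟩).hasDerivWithinAt
    · exact hmid.hasDerivWithinAt
    · have h1 := hα t ⟨by linarith, ht.2⟩
      rw [hζr t htb.le]
      exact (h1.congr_of_eventuallyEq
        (by filter_upwards [Ioi_mem_nhds htb] with s hs using hζr s (le_of_lt hs))).hasDerivWithinAt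
  have hle := hmax _ ζ hsol fun t ht => hζl t (by rw [timeInterval_coe] at ht; exact ht.2)
  have : b + ε ≤ b := by exact_mod_cast hle
  linarith

end

/-! ### Solutions along which an energy dissipates -/

/-- `U` is a nonnegative function of time that decreases along `ξ`, on `[0, T)`, at least at the
rate `‖v‖ ^ 2`; the function `U'` is its right derivative. -/
structure IsEnergy (v : Plane → Plane) (T : EReal) (ξ : ℝ → Plane) (U U' : ℝ → ℝ) : Prop where
  continuousOn : ContinuousOn U (timeInterval T)
  hasDerivWithinAt : ∀ t ∈ timeInterval T, HasDerivWithinAt U (U' t) (Ici t) t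
  deriv_le : ∀ t ∈ timeInterval T, U' t ≤ -‖v (ξ t)‖ ^ 2
  nonneg : ∀ t ∈ timeInterval T, 0 ≤ U t

section

variable {v : Plane → Plane} {T : EReal} {ξ : ℝ → Plane} {U U' : ℝ → ℝ}

lemma IsEnergy.antitoneOn (hU : IsEnergy v T ξ U U') : AntitoneOn U (timeInterval T) := by
  intro s hs t ht hst
  have hsub := Icc_subset_timeInterval hs.1 ht
  exact image_le_of_deriv_right_le_deriv_boundary (B := fun _ => U s) (B' := fun _ => 0)
    (hU.continuousOn.mono hsub)
    (fun x hx => hU.hasDerivWithinAt x (hsub (Ico_subset_Icc_self hx))) le_rfl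
    continuousOn_const (fun x _ => hasDerivWithinAt_const _ _ _)
    (fun x hx => (hU.deriv_le x (hsub (Ico_subset_Icc_self hx))).trans
      (neg_nonpos.2 (sq_nonneg _))) (right_mem_Icc.2 hst)

lemma IsEnergy.norm_sub_le (hU : IsEnergy v T ξ U U') (hξ : IsSolution v T ξ) {s t : ℝ}
    (hs : 0 ≤ s) (hst : s ≤ t) (ht : t ∈ timeInterval T) :
    ‖ξ t - ξ s‖ ≤ (t - U t) - (s - U s) := by
  have hsub := Icc_subset_timeInterval hs ht
  refine image_norm_le_of_norm_deriv_right_le_deriv_boundary' (f := fun x => ξ x - ξ s)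
    (f' := fun x => v (ξ x)) (B := fun x => (x - U x) - (s - U s)) (B' := fun x => 1 - U' x)
    ((hξ.continuousOn.mono hsub).sub continuousOn_const)
    (fun x hx => (hξ.hasDerivWithinAt_Ici (hsub (Ico_subset_Icc_self hx))).sub_const _)
    (by simp) ?_ ?_ ?_ (right_mem_Icc.2 hst)
  · exact (continuousOn_id.sub (hU.continuousOn.mono hsub)).sub continuousOn_const
  · intro x hx
    exact ((hasDerivWithinAt_id _ _).sub
      (hU.hasDerivWithinAt x (hsub (Ico_subset_Icc_self hx)))).sub_const _
  · intro x hx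
    have := hU.deriv_le x (hsub (Ico_subset_Icc_self hx))
    nlinarith [sq_nonneg (‖v (ξ x)‖ - 1), sq_nonneg (‖v (ξ x)‖)]

lemma IsEnergy.exists_tendsto {b : ℝ} (hb : 0 < b) (hξ : IsSolution v b ξ)
    (hU : IsEnergy v b ξ U U') : ∃ x, Tendsto ξ (𝓝[<] b) (𝓝 x) := by
  have hnorm : ∀ s t, 0 ≤ s → s ≤ t → t < b → ‖ξ t - ξ s‖ ≤ (t - U t) - (s - U s) :=
    fun s t hs hst ht => hU.norm_sub_le hξ hs hst
      (by rw [timeInterval_coe]; exact ⟨hs.trans hst, ht⟩)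
  let G : ℝ → ℝ := fun t => t - U t
  have hbdd : BddAbove (G '' Ico 0 b) := by
    refine ⟨b, ?_⟩
    rintro _ ⟨t, ht, rfl⟩
    have := hU.nonneg t (by rw [timeInterval_coe]; exact ht)
    simp only [G]
    linarith [ht.2]
  suffices h : Cauchy (map ξ (𝓝[<] b)) from CompleteSpace.complete h
  refine Metric.cauchy_iff.2 ⟨inferInstance, fun ε hε => ?_⟩
  obtain ⟨_, ⟨s, hs, rfl⟩, hsG⟩ := exists_lt_of_lt_csSup
    (⟨G 0, 0, ⟨le_rfl, hb⟩, rfl⟩ : (G '' Ico 0 b).Nonempty)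
    (sub_lt_self (sSup (G '' Ico 0 b)) (half_pos hε))
  have hlt : ∀ t ∈ Ioo s b, dist (ξ t) (ξ s) < ε / 2 := fun t ht => by
    rw [dist_eq_norm]
    have h1 := hnorm s t hs.1 ht.1.le ht.2
    have h2 : G t ≤ sSup (G '' Ico 0 b) := le_csSup hbdd ⟨t, ⟨hs.1.trans ht.1.le, ht.2⟩, rfl⟩
    simp only [G] at h2 hsG
    linarith
  refine ⟨ξ '' Ioo s b, image_mem_map (Ioo_mem_nhdsLT hs.2), ?_⟩
  rintro _ ⟨t, ht, rfl⟩ _ ⟨t', ht', rfl⟩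
  have := dist_triangle_right (ξ t) (ξ t') (ξ s)
  linarith [hlt t ht, hlt t' ht']

lemma exists_pos_le_dist_of_finite {α : Type*} [MetricSpace α] {C : Set α} (hC : C.Finite) :
    ∃ κ > 0, ∀ p ∈ C, ∀ q ∈ C, p ≠ q → κ ≤ dist p q := by
  rcases C.offDiag.eq_empty_or_nonempty with h | h
  · refine ⟨1, one_pos, fun p hp q hq hpq => ?_⟩
    have : (p, q) ∈ C.offDiag := ⟨hp, hq, hpq⟩
    simp [h] at this
  · obtain ⟨⟨p, q⟩, hpq, hmin⟩ :=
      Set.exists_min_image _ (fun x : α × α => dist x.1 x.2) hC.offDiag h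
    exact ⟨dist p q, dist_pos.2 hpq.2.2, fun p' hp' q' hq' h' => hmin (p', q') ⟨hp', hq', h'⟩⟩

/-- A global solution with an energy finally stays near one zero of `v`. Far from the zeros
the speed is bounded below, so the energy would become negative if the solution stayed there,
and leaving the neighbourhood of a zero costs an amount of energy that is not available after a
long time. -/
lemma IsEnergy.exists_forall_norm_sub_lt (hξ : IsSolution v ⊤ ξ) (hU : IsEnergy v ⊤ ξ U U')
    {C : Set Plane} (hC : C.Finite)
    (hv : ∀ κ > 0, ∃ c > 0, ∀ r, (∀ p ∈ C, κ ≤ dist r p) → c ≤ ‖v r‖) {δ : ℝ} (hδ : 0 < δ) :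
    ∃ c ∈ C, ∃ t₁, 0 ≤ t₁ ∧ ∀ t, t₁ ≤ t → ‖ξ t - c‖ < δ := by
  have hI : ∀ t : ℝ, 0 ≤ t → t ∈ timeInterval ⊤ := fun t ht => by rwa [timeInterval_top]
  obtain ⟨κ₀, hκ₀, hsep⟩ := exists_pos_le_dist_of_finite hC
  obtain ⟨κ, hκ, hκδ, hκκ⟩ : ∃ κ > 0, 4 * κ ≤ δ ∧ 4 * κ ≤ κ₀ :=
    ⟨min δ κ₀ / 4, by positivity, by linarith [min_le_left δ κ₀], by linarith [min_le_right δ κ₀]⟩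
  obtain ⟨c, hc, hcv⟩ := hv κ hκ
  have hbdd : BddBelow (U '' Ici 0) :=
    ⟨0, by rintro _ ⟨t, ht, rfl⟩; exact hU.nonneg t (hI t ht)⟩
  obtain ⟨_, ⟨t₀, ht₀, rfl⟩, hlt⟩ := exists_lt_of_csInf_lt
    (nonempty_Ici.image U)
    (lt_add_of_pos_right (sInf (U '' Ici 0)) (by positivity : 0 < κ * c / 4))
  replace ht₀ : 0 ≤ t₀ := ht₀
  have hdrop : ∀ t, t₀ ≤ t → U t₀ - U t < κ * c / 4 := fun t ht => by
    have := csInf_le hbdd (⟨t, ht₀.trans ht, rfl⟩ : U t ∈ U '' Ici 0)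
    linarith
  obtain ⟨t₁, ht₁, p, hp, hpt⟩ : ∃ t₁, t₀ ≤ t₁ ∧ ∃ p ∈ C, dist (ξ t₁) p < κ := by
    by_contra! hfar
    set τ := t₀ + (U t₀ + 1) / c ^ 2 with hτ
    have hU0 := hU.nonneg t₀ (hI t₀ ht₀)
    have hτ0 : t₀ ≤ τ := by
      have : 0 ≤ (U t₀ + 1) / c ^ 2 := by positivity
      linarith
    have hτI := hI τ (ht₀.trans hτ0)
    have hsub := Icc_subset_timeInterval ht₀ hτI
    have h := image_le_of_deriv_right_le_deriv_boundary (f := U) (f' := U') (a := t₀) (b := τ)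
      (B := fun t => U t₀ - c ^ 2 * (t - t₀)) (B' := fun _ => -c ^ 2)
      (hU.continuousOn.mono hsub)
      (fun x hx => hU.hasDerivWithinAt x (hsub (Ico_subset_Icc_self hx))) (by simp)
      (by fun_prop)
      (fun x _ => by
        simpa using ((((hasDerivAt_id x).sub_const t₀).const_mul (c ^ 2)).const_sub
          (U t₀)).hasDerivWithinAt)
      (fun x hx => by
        have h1 := hcv (ξ x) (hfar x hx.1)
        have h2 := hU.deriv_le x (hsub (Ico_subset_Icc_self hx))
        nlinarith)
      (right_mem_Icc.2 hτ0)
    have h' := hU.nonneg τ hτI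
    have e : c ^ 2 * (τ - t₀) = U t₀ + 1 := by
      rw [hτ]; field_simp; ring
    linarith
  have ht₁0 : 0 ≤ t₁ := ht₀.trans ht₁
  refine ⟨p, hp, t₁, ht₁0, fun t ht => ?_⟩
  have hanti := hU.antitoneOn
  have hsub : Icc t₁ t ⊆ timeInterval ⊤ := Icc_subset_timeInterval ht₁0 (hI t (ht₁0.trans ht))
  -- As long as the barrier is attained, the solution is at distance between `κ` and `2 κ` from `p`,
  -- hence at distance at least `κ` from all points of `C`, so that `‖v‖ < 2 ‖v‖ ^ 2 / c`.
  have hbarrier : ∀ x ∈ Icc t₁ t, κ ≤ κ + 2 / c * (U t₁ - U x) ∧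
      κ + 2 / c * (U t₁ - U x) < 2 * κ := fun x hx => by
    have h1 : U x ≤ U t₁ := hanti (hI t₁ ht₁0) (hsub hx) hx.1
    have h2 : U t₁ ≤ U t₀ := hanti (hI t₀ ht₀) (hI t₁ ht₁0) ht₁
    have h3 := hdrop x (ht₁.trans hx.1)
    refine ⟨?_, ?_⟩
    · have := mul_nonneg (by positivity : 0 ≤ 2 / c) (sub_nonneg.2 h1)
      linarith
    · have h4 : 2 / c * (U t₁ - U x) < 2 / c * (κ * c / 4) :=
        mul_lt_mul_of_pos_left (by linarith) (by positivity)
      have e : 2 / c * (κ * c / 4) = κ / 2 := by field_simp; norm_num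
      linarith
  have h := image_norm_le_of_norm_deriv_right_lt_deriv_boundary' (f := fun x => ξ x - p)
    (f' := fun x => v (ξ x)) (a := t₁) (b := t) (B := fun x => κ + 2 / c * (U t₁ - U x))
    (B' := fun x => 2 / c * -U' x)
    ((hξ.continuousOn.mono hsub).sub continuousOn_const)
    (fun x hx => (hξ.hasDerivWithinAt_Ici (hsub (Ico_subset_Icc_self hx))).sub_const _)
    (by rw [← dist_eq_norm]; simpa using hpt.le)
    (continuousOn_const.add (continuousOn_const.mul
      (continuousOn_const.sub (hU.continuousOn.mono hsub))))
    (fun x hx => (((hU.hasDerivWithinAt x (hsub (Ico_subset_Icc_self hx))).const_sub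
      (U t₁)).const_mul (2 / c)).const_add κ)
    (fun x hx heq => by
      have hx' := Ico_subset_Icc_self hx
      obtain ⟨hb1, hb2⟩ := hbarrier x hx'
      have h1 : c ≤ ‖v (ξ x)‖ := by
        refine hcv _ fun q hq => ?_
        by_cases hqp : q = p
        · rw [hqp, dist_eq_norm, heq]; exact hb1
        · have h2 := hsep q hq p hp hqp
          have h3 := dist_triangle_left q p (ξ x)
          have h4 : dist (ξ x) p < 2 * κ := by rw [dist_eq_norm, heq]; exact hb2
          linarith
      have h2 := hU.deriv_le x (hsub hx')
      have h3 : 0 < ‖v (ξ x)‖ := hc.trans_le h1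
      have h4 : 2 / c * ‖v (ξ x)‖ ^ 2 ≤ 2 / c * -U' x :=
        mul_le_mul_of_nonneg_left (by linarith) (by positivity)
      have h5 : ‖v (ξ x)‖ < 2 / c * ‖v (ξ x)‖ ^ 2 := by
        rw [div_mul_eq_mul_div, lt_div_iff₀ hc]
        nlinarith
      exact h5.trans_le h4)
    (right_mem_Icc.2 ht)
  have := (hbarrier t (right_mem_Icc.2 ht)).2
  linarith

end

/-! ### The guiding field and the error along its solutions -/

lemma rotE_apply_zero (w : Plane) : Matrix.toEuclideanLin rotE w 0 = w 1 := by
  simp [rotE, Matrix.toLpLin_apply, dotProduct]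

lemma rotE_apply_one (w : Plane) : Matrix.toEuclideanLin rotE w 1 = -w 0 := by
  simp [rotE, Matrix.toLpLin_apply, dotProduct]

lemma plane_inner (x y : Plane) : inner ℝ x y = x 0 * y 0 + x 1 * y 1 := by
  simp [PiLp.inner_apply, mul_comm]

lemma plane_norm_sq (x : Plane) : ‖x‖ ^ 2 = x 0 ^ 2 + x 1 ^ 2 := by
  simp [EuclideanSpace.norm_sq_eq]

section

variable {φ : Plane → ℝ} {ψ : ℝ → ℝ} {k : ℝ}

lemma field_apply_zero (r : Plane) :
    field φ ψ k r 0 = ∇ φ r 1 - k * trackingError φ ψ r * ∇ φ r 0 := by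
  simp [field, tangent, rotE_apply_zero]

lemma field_apply_one (r : Plane) :
    field φ ψ k r 1 = -∇ φ r 0 - k * trackingError φ ψ r * ∇ φ r 1 := by
  simp [field, tangent, rotE_apply_one]

lemma inner_gradient_field (r : Plane) :
    inner ℝ (∇ φ r) (field φ ψ k r) = -(k * trackingError φ ψ r) * ‖∇ φ r‖ ^ 2 := by
  rw [plane_inner, plane_norm_sq, field_apply_zero, field_apply_one]
  ring

lemma norm_sq_field (r : Plane) :
    ‖field φ ψ k r‖ ^ 2 = (1 + (k * trackingError φ ψ r) ^ 2) * ‖∇ φ r‖ ^ 2 := by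
  rw [plane_norm_sq, plane_norm_sq, field_apply_zero, field_apply_one]
  ring

lemma norm_gradient_le_norm_field (r : Plane) : ‖∇ φ r‖ ≤ ‖field φ ψ k r‖ := by
  rw [← sq_le_sq₀ (norm_nonneg _) (norm_nonneg _), norm_sq_field]
  nlinarith [mul_nonneg (sq_nonneg (k * trackingError φ ψ r)) (sq_nonneg ‖∇ φ r‖)]

lemma field_eq_zero {r : Plane} (hr : r ∈ criticalSet φ) : field φ ψ k r = 0 := by
  have h : ∇ φ r = 0 := hr
  simp [field, tangent, h]

lemma contDiff_gradient (hφ : ContDiff ℝ 2 φ) : ContDiff ℝ 1 (∇ φ) :=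
  (InnerProductSpace.toDual ℝ Plane).symm.contDiff.comp
    (hφ.fderiv_right (m := 1) (by norm_num))

lemma contDiff_field (hφ : ContDiff ℝ 2 φ) (hψ : ContDiff ℝ 1 ψ) :
    ContDiff ℝ 1 (field φ ψ k) := by
  have h1 := contDiff_gradient hφ
  have h2 : ContDiff ℝ 1 (trackingError φ ψ) := hψ.comp (hφ.of_le (by norm_num))
  exact ((Matrix.toEuclideanLin rotE).toContinuousLinearMap.contDiff.comp h1).sub
    ((contDiff_const.mul h2).smul h1)

lemma IsSolution.hasDerivWithinAt_comp (hφ : ContDiff ℝ 2 φ) {T : EReal} {ξ : ℝ → Plane}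
    (hξ : IsSolution (field φ ψ k) T ξ) {t : ℝ} (ht : t ∈ timeInterval T) :
    HasDerivWithinAt (fun t => φ (ξ t)) (-(k * ψ (φ (ξ t))) * ‖∇ φ (ξ t)‖ ^ 2) (Ici t) t := by
  have h1 := ((hφ.differentiable (by norm_num)) (ξ t)).hasGradientAt.hasFDerivAt
  have h2 := h1.comp_hasDerivWithinAt t (hξ.hasDerivWithinAt_Ici ht)
  rwa [InnerProductSpace.toDual_apply_apply, inner_gradient_field] at h2

lemma mul_apply_nonneg (hψmono : StrictMono ψ) (hψ0 : ψ 0 = 0) (x : ℝ) : 0 ≤ x * ψ x := by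
  rcases le_total 0 x with h | h
  · exact mul_nonneg h (hψ0 ▸ hψmono.monotone h)
  · exact mul_nonneg_of_nonpos_of_nonpos h (hψ0 ▸ hψmono.monotone h)

lemma apply_ne_zero (hψmono : StrictMono ψ) (hψ0 : ψ 0 = 0) {x : ℝ} (hx : x ≠ 0) : ψ x ≠ 0 :=
  fun h => hx (hψmono.injective (h.trans hψ0.symm))

/-- Along a solution, `(φ ^ 2)' = -2 k φ ψ(φ) ‖∇ φ‖ ^ 2 ≤ 0`. -/
lemma antitoneOn_abs_comp (hφ : ContDiff ℝ 2 φ) (hψmono : StrictMono ψ) (hψ0 : ψ 0 = 0)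
    (hk : 0 < k) {T : EReal} {ξ : ℝ → Plane} (hξ : IsSolution (field φ ψ k) T ξ) :
    AntitoneOn (fun t => |φ (ξ t)|) (timeInterval T) := by
  intro s hs t ht hst
  have hsub := Icc_subset_timeInterval hs.1 ht
  have h : φ (ξ t) ^ 2 ≤ φ (ξ s) ^ 2 := by
    refine image_le_of_deriv_right_le_deriv_boundary (f := fun t => φ (ξ t) ^ 2)
      (B := fun _ => φ (ξ s) ^ 2) (B' := fun _ => 0)
      ((hφ.continuous.comp_continuousOn (hξ.continuousOn.mono hsub)).pow 2)
      (fun x hx => (hξ.hasDerivWithinAt_comp hφ (hsub (Ico_subset_Icc_self hx))).pow 2) le_rfl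
      continuousOn_const (fun x _ => hasDerivWithinAt_const _ _ _) (fun x _ => ?_)
      (right_mem_Icc.2 hst)
    have h1 := mul_nonneg (mul_nonneg hk.le (mul_apply_nonneg hψmono hψ0 (φ (ξ x))))
      (sq_nonneg ‖∇ φ (ξ x)‖)
    simp only [Nat.cast_ofNat, Nat.add_one_sub_one, pow_one]
    nlinarith
  exact sq_le_sq.1 h

/-- A solution that does not converge to the path has an energy, namely a multiple of `φ ^ 2`:
since `|φ|` stays in a compact subinterval of `(0, ∞)`, the dissipation of `φ ^ 2` is comparable
with `‖∇ φ‖ ^ 2`, hence with `‖v‖ ^ 2`. -/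
lemma exists_isEnergy (hφ : ContDiff ℝ 2 φ) (hψ : ContDiff ℝ 1 ψ) (hψmono : StrictMono ψ)
    (hψ0 : ψ 0 = 0) (hk : 0 < k)
    (hpath : BoundedAwayFromZeroOff (trackingError φ ψ) (path φ))
    {T : EReal} (hT : 0 < T) {ξ : ℝ → Plane} (hξ : IsSolution (field φ ψ k) T ξ)
    (hnot : ¬ ConvergesTo ξ T (path φ)) : ∃ U U', IsEnergy (field φ ψ k) T ξ U U' := by
  have hanti := antitoneOn_abs_comp hφ hψmono hψ0 hk hξ
  obtain ⟨m, hm, hmle⟩ : ∃ m > 0, ∀ t ∈ timeInterval T, m ≤ |φ (ξ t)| := by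
    by_contra! h
    refine hnot fun ε hε => ?_
    obtain ⟨c, hc, hcr⟩ := hpath ε hε
    obtain ⟨δ, hδ, hδc⟩ := Metric.continuousAt_iff.1 (hψ.continuous.continuousAt (x := 0)) c hc
    obtain ⟨t₀, ht₀, hlt⟩ := h δ hδ
    refine ⟨t₀, ht₀, fun t ht htt => ?_⟩
    by_contra! hfar
    have h1 := hcr _ hfar
    have h2 : |φ (ξ t)| < δ := (hanti ht₀ ht htt).trans_lt hlt
    have h3 := @hδc (φ (ξ t)) (by simpa using h2)
    rw [hψ0, dist_zero_right] at h3
    exact absurd h1 (not_le.2 h3)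
  set M := |φ (ξ 0)| with hM
  have h0 : (0 : ℝ) ∈ timeInterval T := ⟨le_rfl, by exact_mod_cast hT⟩
  have hMle : ∀ t ∈ timeInterval T, |φ (ξ t)| ≤ M := fun t ht => hanti h0 ht ht.1
  set E := max (ψ M) (-ψ (-M)) with hE
  have hEle : ∀ t ∈ timeInterval T, ψ (φ (ξ t)) ^ 2 ≤ E ^ 2 := fun t ht => by
    have h1 := abs_le.1 (hMle t ht)
    have h2 := hψmono.monotone h1.1
    have h3 := hψmono.monotone h1.2
    refine sq_le_sq' ?_ (h3.trans (le_max_left _ _))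
    linarith [le_max_right (ψ M) (-ψ (-M))]
  set b := m * min (ψ m) (-ψ (-m)) with hb
  have hψm : 0 < ψ m := hψ0 ▸ hψmono hm
  have hψm' : ψ (-m) < 0 := hψ0 ▸ hψmono (neg_lt_zero.2 hm)
  have hb0 : 0 < b := mul_pos hm (lt_min hψm (neg_pos.2 hψm'))
  have hble : ∀ t ∈ timeInterval T, b ≤ φ (ξ t) * ψ (φ (ξ t)) := fun t ht => by
    rcases le_abs.1 (hmle t ht) with h | h
    · exact mul_le_mul h ((min_le_left _ _).trans (hψmono.monotone h))
        (lt_min hψm (neg_pos.2 hψm')).le (hm.le.trans h)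
    · rw [← neg_mul_neg]
      refine mul_le_mul h ((min_le_right _ _).trans (neg_le_neg (hψmono.monotone ?_)))
        (lt_min hψm (neg_pos.2 hψm')).le (hm.le.trans h)
      linarith
  set C := (1 + (k * E) ^ 2) / (2 * k * b) with hC
  have hC0 : 0 ≤ C := by positivity
  have hCe : C * (2 * k * b) = 1 + (k * E) ^ 2 := by rw [hC]; field_simp
  refine ⟨fun t => C * φ (ξ t) ^ 2,
    fun t => C * (2 * φ (ξ t) * (-(k * ψ (φ (ξ t))) * ‖∇ φ (ξ t)‖ ^ 2)), ?_, ?_, ?_, ?_⟩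
  · exact continuousOn_const.mul ((hφ.continuous.comp_continuousOn hξ.continuousOn).pow 2)
  · intro t ht
    simpa using ((hξ.hasDerivWithinAt_comp hφ ht).pow 2).const_mul C
  · intro t ht
    rw [norm_sq_field]
    have hn := sq_nonneg ‖∇ φ (ξ t)‖
    have h1 : (k * trackingError φ ψ (ξ t)) ^ 2 ≤ (k * E) ^ 2 := by
      rw [mul_pow, mul_pow]
      exact mul_le_mul_of_nonneg_left (hEle t ht) (sq_nonneg k)
    have h2 := mul_le_mul_of_nonneg_right (add_le_add_right h1 1) hn
    have h3 : C * (2 * k * b) * ‖∇ φ (ξ t)‖ ^ 2 ≤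
        C * (2 * k * (φ (ξ t) * ψ (φ (ξ t)))) * ‖∇ φ (ξ t)‖ ^ 2 :=
      mul_le_mul_of_nonneg_right (mul_le_mul_of_nonneg_left
        (mul_le_mul_of_nonneg_left (hble t ht) (by positivity)) hC0) hn
    rw [hCe] at h3
    linarith
  · intro t _
    positivity

lemma exists_le_norm_field_of_far
    (hcrit : BoundedAwayFromZeroOff (gradient φ) (criticalSet φ)) :
    ∀ κ > 0, ∃ c > 0, ∀ r, (∀ p ∈ criticalSet φ, κ ≤ dist r p) → c ≤ ‖field φ ψ k r‖ := by
  intro κ hκ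
  obtain ⟨c, hc, h⟩ := hcrit κ hκ
  refine ⟨c, hc, fun r hr => (h r ?_).trans (norm_gradient_le_norm_field r)⟩
  refine le_infEDist.2 fun p hp => ?_
  rw [edist_dist]
  exact ENNReal.ofReal_le_ofReal (hr p hp)

/-- A maximal solution either converges to the path or is global and finally stays near one
critical point. -/
lemma convergesTo_or_near_criticalSet (hφ : ContDiff ℝ 2 φ) (hψ : ContDiff ℝ 1 ψ)
    (hψmono : StrictMono ψ) (hψ0 : ψ 0 = 0) (hk : 0 < k)
    (hpath : BoundedAwayFromZeroOff (trackingError φ ψ) (path φ))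
    (hcrit : BoundedAwayFromZeroOff (gradient φ) (criticalSet φ))
    (hfin : (criticalSet φ).Finite) {T : EReal} {ξ : ℝ → Plane}
    (hξ : IsMaximalSolution (field φ ψ k) T ξ) :
    ConvergesTo ξ T (path φ) ∨ T = ⊤ ∧ ∀ δ > 0, ∃ c ∈ criticalSet φ, ∃ t₁, 0 ≤ t₁ ∧
      ∀ t, t₁ ≤ t → ‖ξ t - c‖ < δ := by
  by_cases hnot : ConvergesTo ξ T (path φ)
  · exact Or.inl hnot
  obtain ⟨U, U', hU⟩ := exists_isEnergy hφ hψ hψmono hψ0 hk hpath hξ.1 hξ.2.1 hnot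
  right
  induction T with
  | bot => exact absurd hξ.1 (by simp)
  | top =>
    exact ⟨rfl, fun δ hδ => hU.exists_forall_norm_sub_lt hξ.2.1 hfin
      (exists_le_norm_field_of_far hcrit) hδ⟩
  | coe b =>
    obtain ⟨x, hx⟩ := hU.exists_tendsto (by exact_mod_cast hξ.1) hξ.2.1
    exact absurd hx (hξ.not_tendsto (contDiff_field hφ hψ) x)

end

/-! ### Pairs of solutions near a critical point -/

/-- If a bilinear form `B` grows along the linearization of `v` at `c`, then it is nonpositive on
the difference of two solutions that remain near `c`: otherwise it would grow exponentially
along this difference. -/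
lemma exists_forall_form_nonpos {v : Plane → Plane} {c : Plane} {A : Plane →L[ℝ] Plane}
    (hv : HasStrictFDerivAt v A c) (B : Plane →L[ℝ] Plane →L[ℝ] ℝ) {a m : ℝ} (ha : 0 < a)
    (hm : 0 < m) (hB : ∀ w, a * B w w + m * ‖w‖ ^ 2 ≤ B (A w) w + B w (A w)) :
    ∃ δ > 0, ∀ ξ η : ℝ → Plane, IsSolution v ⊤ ξ → IsSolution v ⊤ η → ∀ s : ℝ, 0 ≤ s →
      (∀ t, s ≤ t → ‖ξ t - c‖ < δ) → (∀ t, s ≤ t → ‖η t - c‖ < δ) →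
      B (ξ s - η s) (ξ s - η s) ≤ 0 := by
  set ε := m / (2 * ‖B‖ + 1) with hε
  have hε0 : 0 < ε := by positivity
  have hεB : 2 * ‖B‖ * ε ≤ m := by
    rw [hε, mul_div_assoc', div_le_iff₀ (by positivity)]
    nlinarith [norm_nonneg B]
  obtain ⟨δ, hδ, hlin⟩ := Metric.eventually_nhds_iff.1 (hv.isLittleO.def hε0)
  refine ⟨δ, hδ, fun ξ η hξ hη s hs hξc hηc => ?_⟩
  by_contra! hpos
  have hI : ∀ t, s ≤ t → t ∈ timeInterval ⊤ := fun t ht => by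
    rw [timeInterval_top]; exact hs.trans ht
  set q : ℝ → ℝ := fun t => B (ξ t - η t) (ξ t - η t) with hq
  have hgrow : ∀ t, s ≤ t → q s * Real.exp (a * (t - s)) ≤ q t := by
    intro t hst
    have hsub := Icc_subset_timeInterval hs (hI t hst)
    have hc : ContinuousOn (fun t => ξ t - η t) (Icc s t) :=
      (hξ.continuousOn.mono hsub).sub (hη.continuousOn.mono hsub)
    refine mul_exp_le_of_mul_le_deriv
      (q' := fun t => B (ξ t - η t) (v (ξ t) - v (η t)) + B (v (ξ t) - v (η t)) (ξ t - η t))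
      hst ((B.continuous.comp_continuousOn hc).clm_apply hc) (fun x hx => ?_) (fun x hx => ?_)
    · have hx0 : 0 < x := hs.trans_lt hx.1
      have hxI := hI x hx.1.le
      have hd := (hξ.hasDerivAt hxI hx0).sub (hη.hasDerivAt hxI hx0)
      have hd' := (B.hasFDerivAt.comp_hasDerivAt x hd).clm_apply hd
      rw [add_comm]
      exact hd'
    · have h1 := @hlin (ξ x, η x) (by
        rw [Prod.dist_eq, dist_eq_norm, dist_eq_norm]
        exact max_lt (hξc x hx.1.le) (hηc x hx.1.le))
      simp only at h1
      set w := ξ x - η x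
      set z := v (ξ x) - v (η x)
      have h2 : |B (z - A w) w| ≤ ‖B‖ * (ε * ‖w‖) * ‖w‖ :=
        (B.le_opNorm₂ _ _).trans (by gcongr)
      have h3 : |B w (z - A w)| ≤ ‖B‖ * ‖w‖ * (ε * ‖w‖) :=
        (B.le_opNorm₂ _ _).trans (by gcongr)
      have h4 := neg_le_of_abs_le h2
      have h5 := neg_le_of_abs_le h3
      have h6 := hB w
      simp only [map_sub, sub_apply] at h4 h5
      have h7 := mul_le_mul_of_nonneg_right hεB (sq_nonneg ‖w‖)
      change a * B w w ≤ B w z + B z w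
      linarith
  have hbound : ∀ t, s ≤ t → q t ≤ ‖B‖ * (2 * δ) * (2 * δ) := fun t ht => by
    have h1 : ‖ξ t - η t‖ ≤ 2 * δ := by
      have := norm_sub_le (ξ t - c) (η t - c)
      rw [sub_sub_sub_cancel_right] at this
      linarith [hξc t ht, hηc t ht]
    exact (le_abs_self _).trans ((B.le_opNorm₂ _ _).trans (by gcongr))
  set D := ‖B‖ * (2 * δ) * (2 * δ) with hD
  have hD0 : 0 ≤ D := by positivity
  have hq0 : 0 < q s := hpos
  have hst : s ≤ s + D / (q s * a) := le_add_of_nonneg_right (by positivity)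
  have h1 := (hgrow _ hst).trans (hbound _ hst)
  have h2 := Real.add_one_le_exp (a * (s + D / (q s * a) - s))
  have e : q s * (a * (s + D / (q s * a) - s)) = D := by
    rw [add_sub_cancel_left]; field_simp
  have h3 := mul_le_mul_of_nonneg_left h2 hq0.le
  rw [mul_add, e] at h3
  linarith

section Linearization

variable {φ : Plane → ℝ} {ψ : ℝ → ℝ} {k : ℝ}

lemma gradient_apply (r : Plane) (j : Fin 2) :
    ∇ φ r j = fderiv ℝ φ r (EuclideanSpace.single j 1) := by
  have h : inner ℝ (∇ φ r) (EuclideanSpace.single j (1 : ℝ)) =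
      fderiv ℝ φ r (EuclideanSpace.single j 1) := by
    rw [gradient, InnerProductSpace.toDual_symm_apply]
  rw [← h, EuclideanSpace.inner_single_right]
  simp

lemma hessian_eq_fderiv_gradient (hφ : ContDiff ℝ 2 φ) (r : Plane) (i j : Fin 2) :
    hessian φ r i j = fderiv ℝ (∇ φ) r (EuclideanSpace.single i 1) j := by
  have hd : DifferentiableAt ℝ (∇ φ) r := (contDiff_gradient hφ).differentiable one_ne_zero r
  have h : HasFDerivAt (fun s => ∇ φ s j)
      ((EuclideanSpace.proj j : Plane →L[ℝ] ℝ).comp (fderiv ℝ (∇ φ) r)) r :=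
    (EuclideanSpace.proj j : Plane →L[ℝ] ℝ).hasFDerivAt.comp r hd.hasFDerivAt
  simp only [gradient_apply] at h
  simp [hessian, h.fderiv]

lemma fderiv_gradient_apply (hφ : ContDiff ℝ 2 φ) (r w : Plane) (j : Fin 2) :
    fderiv ℝ (∇ φ) r w j = w 0 * hessian φ r 0 j + w 1 * hessian φ r 1 j := by
  have hw : w = w 0 • EuclideanSpace.single 0 1 + w 1 • EuclideanSpace.single 1 1 := by
    ext i; fin_cases i <;> simp
  conv_lhs => rw [hw]
  simp [hessian_eq_fderiv_gradient hφ]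

lemma hessian_symm (hφ : ContDiff ℝ 2 φ) (r : Plane) : hessian φ r 0 1 = hessian φ r 1 0 := by
  have hd : DifferentiableAt ℝ (fderiv ℝ φ) r :=
    (hφ.fderiv_right (m := 1) (by norm_num)).differentiable one_ne_zero r
  have h : ∀ i j : Fin 2, hessian φ r i j = fderiv ℝ (fderiv ℝ φ) r
      (EuclideanSpace.single i 1) (EuclideanSpace.single j 1) := fun i j => by
    simp [hessian, fderiv_clm_apply hd (differentiableAt_const _)]
  rw [h, h]
  exact (hφ.contDiffAt.isSymmSndFDerivAt (by simp)).eq _ _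

/-- The derivative of the field at a critical point `c` is `(E - k e(c)) H(c)`. -/
lemma exists_hasStrictFDerivAt_field (hφ : ContDiff ℝ 2 φ) (hψ : ContDiff ℝ 1 ψ) {c : Plane}
    (hc : c ∈ criticalSet φ) : ∃ A : Plane →L[ℝ] Plane, HasStrictFDerivAt (field φ ψ k) A c ∧
      ∀ w, A w 0 = fderiv ℝ (∇ φ) c w 1 - k * trackingError φ ψ c * fderiv ℝ (∇ φ) c w 0 ∧
        A w 1 = -fderiv ℝ (∇ φ) c w 0 - k * trackingError φ ψ c * fderiv ℝ (∇ φ) c w 1 := by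
  have hg := ((contDiff_gradient hφ).contDiffAt (x := c)).hasStrictFDerivAt one_ne_zero
  have he : ContDiff ℝ 1 (trackingError φ ψ) := hψ.comp (hφ.of_le (by norm_num))
  have he' := (he.contDiffAt (x := c)).hasStrictFDerivAt one_ne_zero
  have h := ((Matrix.toEuclideanLin rotE).toContinuousLinearMap.hasStrictFDerivAt.comp c hg).sub
    ((he'.const_mul k).smul hg)
  have hc0 : ∇ φ c = 0 := hc
  refine ⟨_, h, fun w => ⟨?_, ?_⟩⟩ <;> simp [hc0, rotE_apply_zero, rotE_apply_one]

/-- The orthonormal eigenframe `(a, b)`, `(b, -a)` of a symmetric matrix that has a negative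
eigenvalue `-ρ`; the other eigenvalue is `-ν`. -/
lemma exists_eigenframe {M : Matrix (Fin 2) (Fin 2) ℝ} (hM : M 0 1 = M 1 0)
    (hneg : HasNegativeEigenvalue M) : ∃ a b ρ ν : ℝ, a ^ 2 + b ^ 2 = 1 ∧ 0 < ρ ∧
      a * M 0 0 + b * M 0 1 = -ρ * a ∧ a * M 0 1 + b * M 1 1 = -ρ * b ∧
      b * M 0 0 - a * M 0 1 = -ν * b ∧ b * M 0 1 - a * M 1 1 = ν * a ∧
      ((-M).PosDef → 0 < ν) := by
  obtain ⟨μ, hμ, hev⟩ := hneg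
  obtain ⟨f, hf⟩ := hev.exists_hasEigenvector
  have hMf := hf.apply_eq_smul
  have hf0 := hf.2
  have e0 := congrFun hMf 0
  have e1 := congrFun hMf 1
  simp only [Matrix.toLin'_apply, Matrix.mulVec, dotProduct, Fin.sum_univ_two, Pi.smul_apply,
    smul_eq_mul] at e0 e1
  rw [← hM] at e1
  have hpos : 0 < f 0 ^ 2 + f 1 ^ 2 := by
    rcases eq_or_ne (f 0) 0 with h | h
    · have : f 1 ≠ 0 := fun h' => hf0 (by ext i; fin_cases i <;> simp [h, h'])
      positivity
    · positivity
  set N := Real.sqrt (f 0 ^ 2 + f 1 ^ 2) with hN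
  have hN0 : 0 < N := Real.sqrt_pos.2 hpos
  have hN2 : N ^ 2 = f 0 ^ 2 + f 1 ^ 2 := Real.sq_sqrt hpos.le
  obtain ⟨a, ha⟩ : ∃ a, a = f 0 / N := ⟨_, rfl⟩
  obtain ⟨b, hb⟩ : ∃ b, b = f 1 / N := ⟨_, rfl⟩
  have hab : a ^ 2 + b ^ 2 = 1 := by rw [ha, hb]; field_simp; linarith
  have h0 : a * M 0 0 + b * M 0 1 = μ * a := by rw [ha, hb]; field_simp; linarith
  have h1 : a * M 0 1 + b * M 1 1 = μ * b := by rw [ha, hb]; field_simp; linarith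
  refine ⟨a, b, -μ, -(M 0 0 * b ^ 2 - 2 * M 0 1 * a * b + M 1 1 * a ^ 2), hab, neg_pos.2 hμ,
    by linarith, by linarith, ?_, ?_, fun hP => ?_⟩
  · linear_combination (b * M 0 0 - a * M 0 1) * (-hab) + a * b * h0 - a ^ 2 * h1
  · linear_combination (b * M 0 1 - a * M 1 1) * (-hab) + b ^ 2 * h0 - a * b * h1
  · have hne : (![b, -a] : Fin 2 → ℝ) ≠ 0 := fun h => by
      have hb0 : b = 0 := by simpa using congrFun h 0
      have ha0 : a = 0 := by simpa using congrFun h 1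
      simp [hb0, ha0] at hab
    have h := hP.dotProduct_mulVec_pos hne
    simp [Matrix.mulVec, dotProduct, Fin.sum_univ_two] at h
    rw [← hM] at h
    linarith

/-- In the eigenframe of `-e H`, with eigenvalues `ρ > 0` and `ν`, some diagonal form
`ρ x ^ 2 + γ y ^ 2` grows along the linear field `(E - k e) H`. If `ν > 0`, then `γ = ν` works;
otherwise some `γ < ν` does, and the form does not degenerate even if `ν = 0`. -/
lemma exists_growing_form {e k ρ ν : ℝ} (he : e ≠ 0) (hk : 0 < k) (hρ : 0 < ρ) :
    ∃ γ a m : ℝ, 0 < a ∧ 0 < m ∧ (0 < ν → 0 < γ) ∧ ∀ x y : ℝ,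
      a * (ρ * x ^ 2 + γ * y ^ 2) + m * (x ^ 2 + y ^ 2) ≤
        2 * (ρ * (x * (k * ρ * x + ν / e * y)) + γ * (y * (k * ν * y - ρ / e * x))) := by
  rcases lt_or_ge 0 ν with hν | hν
  · obtain ⟨d, hd, hdρ, hdν⟩ : ∃ d > 0, d ≤ ρ ∧ d ≤ ν :=
      ⟨min ρ ν, lt_min hρ hν, min_le_left _ _, min_le_right _ _⟩
    refine ⟨ν, k * d, k * d ^ 2, by positivity, by positivity, fun h => h, fun x y => ?_⟩
    have e1 : 2 * (ρ * (x * (k * ρ * x + ν / e * y)) + ν * (y * (k * ν * y - ρ / e * x))) =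
        2 * k * (ρ ^ 2 * x ^ 2 + ν ^ 2 * y ^ 2) := by ring
    rw [e1]
    have h1 : d * ρ + d ^ 2 ≤ 2 * ρ ^ 2 := by nlinarith
    have h2 : d * ν + d ^ 2 ≤ 2 * ν ^ 2 := by nlinarith
    have h3 := mul_le_mul_of_nonneg_left h1 (mul_nonneg hk.le (sq_nonneg x))
    have h4 := mul_le_mul_of_nonneg_left h2 (mul_nonneg hk.le (sq_nonneg y))
    linarith
  · -- With `γ = ν - k ^ 2 e ^ 2 ρ / 2` and `a = k ρ`, the difference of the two sides for `m = 0`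
    -- is at least `k ρ ^ 2 (x ^ 2 + k e x y + (k e) ^ 2 y ^ 2 / 2)`.
    set s := k ^ 2 * e ^ 2 * ρ / 2 with hs
    have hs0 : 0 < s := by positivity
    obtain ⟨d, hd, hd1, hd2⟩ : ∃ d > 0, d ≤ 1 / 3 ∧ d ≤ (k * e) ^ 2 / 8 :=
      ⟨min (1 / 3) ((k * e) ^ 2 / 8), lt_min (by norm_num) (by positivity), min_le_left _ _,
        min_le_right _ _⟩
    refine ⟨ν - s, k * ρ, k * ρ ^ 2 * d, by positivity, by positivity,
      fun h => absurd hν (not_le.2 h), fun x y => ?_⟩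
    have e1 : 2 * (ρ * (x * (k * ρ * x + ν / e * y)) +
        (ν - s) * (y * (k * ν * y - ρ / e * x))) =
        2 * k * ρ ^ 2 * x ^ 2 + k ^ 2 * e * ρ ^ 2 * (x * y) -
          2 * k * ν * (s - ν) * y ^ 2 := by
      rw [hs]; field_simp; ring
    rw [e1]
    have h1 : 0 ≤ k * (ρ * -ν) * y ^ 2 := by
      have := mul_nonneg hρ.le (neg_nonneg.2 hν)
      positivity
    have h2 : 0 ≤ k * (-ν * (s - ν)) * y ^ 2 := by
      have : 0 ≤ -ν * (s - ν) := mul_nonneg (neg_nonneg.2 hν) (by linarith)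
      positivity
    have h3 : d * (x ^ 2 + y ^ 2) ≤ x ^ 2 + k * e * (x * y) + (k * e) ^ 2 / 2 * y ^ 2 := by
      nlinarith [mul_le_mul_of_nonneg_right hd1 (sq_nonneg x),
        mul_le_mul_of_nonneg_right hd2 (sq_nonneg y), sq_nonneg (x + 3 / 4 * (k * e) * y)]
    have h4 := mul_le_mul_of_nonneg_left h3 (by positivity : 0 ≤ k * ρ ^ 2)
    have e2 : k * ρ ^ 2 * ((k * e) ^ 2 / 2 * y ^ 2) = k * ρ * s * y ^ 2 := by rw [hs]; ring
    linarith

/-- Near a critical point at which `e H` has a negative eigenvalue, the difference of two solutions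
that remain nearby is controlled by one linear coordinate, and vanishes if `e H` is negative
definite. This replaces a local centre-stable manifold. -/
lemma exists_controlling_coordinate (hφ : ContDiff ℝ 2 φ) (hψ : ContDiff ℝ 1 ψ) (hk : 0 < k)
    {c : Plane} (hc : c ∈ criticalSet φ) (he : trackingError φ ψ c ≠ 0)
    (hneg : HasNegativeEigenvalue (trackingError φ ψ c • hessian φ c)) :
    ∃ δ > 0, ∃ (K : ℝ≥0) (l : Plane →L[ℝ] ℝ),
      ((-(trackingError φ ψ c • hessian φ c)).PosDef → K = 0) ∧
      ∀ ξ η : ℝ → Plane, IsSolution (field φ ψ k) ⊤ ξ → IsSolution (field φ ψ k) ⊤ η →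
        ∀ s : ℝ, 0 ≤ s → (∀ t, s ≤ t → ‖ξ t - c‖ < δ) → (∀ t, s ≤ t → ‖η t - c‖ < δ) →
        ‖ξ s - η s‖ ≤ K * |l (ξ s) - l (η s)| := by
  obtain ⟨A, hA, hAw⟩ := exists_hasStrictFDerivAt_field (k := k) hφ hψ hc
  obtain ⟨a, b, ρ, ν, hab, hρ, h1, h2, h3, h4, hP⟩ :=
    exists_eigenframe (by simp [hessian_symm hφ]) hneg
  set e := trackingError φ ψ c
  obtain ⟨γ, α, m, hα, hm, hγ, hform⟩ := exists_growing_form (ν := ν) he hk hρ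
  let p : Fin 2 → Plane →L[ℝ] ℝ := fun i => EuclideanSpace.proj i
  let x : Plane →L[ℝ] ℝ := a • p 0 + b • p 1
  let y : Plane →L[ℝ] ℝ := b • p 0 - a • p 1
  have hx : ∀ w, x w = a * w 0 + b * w 1 := fun w => by simp [x, p]
  have hy : ∀ w, y w = b * w 0 - a * w 1 := fun w => by simp [y, p]
  have hxy : ∀ w, ‖w‖ ^ 2 = x w ^ 2 + y w ^ 2 := fun w => by
    rw [plane_norm_sq, hx, hy]
    linear_combination (-(w 0 ^ 2 + w 1 ^ 2)) * hab
  have hg : ∀ w, e * (a * fderiv ℝ (∇ φ) c w 0 + b * fderiv ℝ (∇ φ) c w 1) = -ρ * x w ∧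
      e * (b * fderiv ℝ (∇ φ) c w 0 - a * fderiv ℝ (∇ φ) c w 1) = -ν * y w := fun w => by
    simp only [Matrix.smul_apply, smul_eq_mul] at h1 h2 h3 h4
    rw [fderiv_gradient_apply hφ, fderiv_gradient_apply hφ, hx, hy, ← hessian_symm hφ]
    constructor
    · linear_combination w 0 * h1 + w 1 * h2
    · linear_combination w 0 * h3 + w 1 * h4
  have hxA : ∀ w, x (A w) = k * ρ * x w + ν / e * y w := fun w => by
    obtain ⟨g1, g2⟩ := hg w
    rw [hx, (hAw w).1, (hAw w).2]
    field_simp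
    linear_combination (-(k * e)) * g1 - g2
  have hyA : ∀ w, y (A w) = k * ν * y w - ρ / e * x w := fun w => by
    obtain ⟨g1, g2⟩ := hg w
    rw [hy, (hAw w).1, (hAw w).2]
    field_simp
    linear_combination g1 - (k * e) * g2
  let B : Plane →L[ℝ] Plane →L[ℝ] ℝ := ρ • x.smulRight x + γ • y.smulRight y
  have hB : ∀ w z, B w z = ρ * (x w * x z) + γ * (y w * y z) := fun w z => by simp [B]
  obtain ⟨δ, hδ, hcmp⟩ := exists_forall_form_nonpos hA B hα hm fun w => by
    have h := hform (x w) (y w)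
    rw [hB, hB, hB, hxA, hyA, hxy]
    linarith
  refine ⟨δ, hδ, ?_⟩
  have hQ : ∀ w, B w w ≤ 0 → ρ * x w ^ 2 + γ * y w ^ 2 ≤ 0 := fun w hw => by
    rw [hB] at hw; linarith
  rcases lt_or_ge 0 γ with hγ0 | hγ0
  · refine ⟨0, 0, fun _ => rfl, fun ξ η hξ hη s hs h h' => ?_⟩
    have hw := hQ _ (hcmp ξ η hξ hη s hs h h')
    set w := ξ s - η s
    have hx0 : x w ^ 2 ≤ 0 := by
      have := mul_nonneg hγ0.le (sq_nonneg (y w))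
      nlinarith
    have hy0 : y w ^ 2 ≤ 0 := by
      have := mul_nonneg hρ.le (sq_nonneg (x w))
      nlinarith
    have hw0 : ‖w‖ ^ 2 ≤ 0 := by rw [hxy]; linarith
    simpa using hw0
  · have hK : 0 ≤ -γ / ρ + 1 := by
      have := div_nonneg (neg_nonneg.2 hγ0) hρ.le
      linarith
    refine ⟨⟨Real.sqrt (-γ / ρ + 1), Real.sqrt_nonneg _⟩, y,
      fun h => absurd (hγ (hP h)) (not_lt.2 hγ0), fun ξ η hξ hη s hs h h' => ?_⟩
    have hw := hQ _ (hcmp ξ η hξ hη s hs h h')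
    rw [← map_sub]
    set w := ξ s - η s
    have hxw : x w ^ 2 ≤ -γ / ρ * y w ^ 2 := by
      rw [div_mul_eq_mul_div, le_div_iff₀ hρ]; linarith
    change ‖w‖ ≤ Real.sqrt (-γ / ρ + 1) * |y w|
    refine abs_le_of_sq_le_sq' ?_ (by positivity) |>.2
    rw [mul_pow, Real.sq_sqrt hK, sq_abs, hxy]
    linarith

end Linearization

/-! ### The exceptional initial conditions -/

/-- A subset of the plane that admits an antilipschitz map to the line is a null set, because its
Hausdorff dimension is at most one. -/
lemma volume_eq_zero_of_antilipschitz {S : Set Plane} (f : S → ℝ) {K : ℝ≥0}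
    (hf : AntilipschitzWith K f) : MeasureTheory.volume S = 0 := by
  have h1 : dimH S ≤ 1 := by
    have h2 := hf.le_dimH_image univ
    rw [← isometry_subtype_coe.dimH_image, image_univ, Subtype.range_coe] at h2
    exact h2.trans ((dimH_mono (subset_univ _)).trans Real.dimH_univ.le)
  have hac : (MeasureTheory.volume : MeasureTheory.Measure Plane).AbsolutelyContinuous
      (MeasureTheory.Measure.hausdorffMeasure ((2 : ℝ≥0) : ℝ)) := by
    have h3 := MeasureTheory.isAddHaarMeasure_hausdorffMeasure (E := Plane)
    simp only [finrank_euclideanSpace, Fintype.card_fin] at h3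
    have h4 := MeasureTheory.Measure.absolutelyContinuous_isAddHaarMeasure
      (MeasureTheory.volume : MeasureTheory.Measure Plane)
      (MeasureTheory.Measure.hausdorffMeasure ((2 : ℕ) : ℝ))
    simpa using h4
  exact measure_zero_of_dimH_lt hac (h1.trans_lt (by norm_num))

/-- The initial values of the solutions that stay in the ball of radius `R` up to the time `s`
and at distance less than `δ` from `c` afterwards. -/
def trappedSet (v : Plane → Plane) (c : Plane) (δ s R : ℝ) : Set Plane :=
  {x | ∃ ξ : ℝ → Plane, IsSolution v ⊤ ξ ∧ ξ 0 = x ∧ (∀ t ∈ Icc 0 s, ‖ξ t‖ ≤ R) ∧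
    ∀ t, s ≤ t → ‖ξ t - c‖ < δ}

/-- If near `c` the differences of trapped solutions are controlled by one linear coordinate at
time `s`, then Gronwall's inequality backwards in time makes this coordinate, as a function of the
initial value, antilipschitz. -/
lemma volume_trappedSet {v : Plane → Plane} (hv : ContDiff ℝ 1 v) {c : Plane} {δ s R : ℝ}
    (hs : 0 ≤ s) {K : ℝ≥0} {l : Plane →L[ℝ] ℝ}
    (hl : ∀ ξ η : ℝ → Plane, IsSolution v ⊤ ξ → IsSolution v ⊤ η →
      (∀ t, s ≤ t → ‖ξ t - c‖ < δ) → (∀ t, s ≤ t → ‖η t - c‖ < δ) →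
      ‖ξ s - η s‖ ≤ K * |l (ξ s) - l (η s)|) :
    MeasureTheory.volume (trappedSet v c δ s R) = 0 := by
  obtain ⟨L, hL⟩ := exists_lipschitzOnWith_closedBall hv R
  choose ξ hξ hξ0 hξR hξc using fun x : trappedSet v c δ s R => x.2
  have hsT : s ∈ timeInterval ⊤ := by rwa [timeInterval_top]
  refine volume_eq_zero_of_antilipschitz (fun x => l (ξ x s))
    (K := ⟨Real.exp (L * s), (Real.exp_pos _).le⟩ * K) (AntilipschitzWith.of_le_mul_dist ?_)
  intro x y
  have h1 := ((hξ x).sq_norm_sub_bounds (hξ y) hL le_rfl hs hsT hsT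
    (fun t ht => by simpa using hξR x t ht) (fun t ht => by simpa using hξR y t ht)).1
  have h2 := hl _ _ (hξ x) (hξ y) (hξc x) (hξc y)
  rw [hξ0, hξ0] at h1
  have h3 : ‖(x : Plane) - y‖ ≤ Real.exp (L * s) * ‖ξ x s - ξ y s‖ := by
    refine (abs_le_of_sq_le_sq' ?_ (by positivity)).2
    have h4 := mul_le_mul_of_nonneg_left h1 (sq_nonneg (Real.exp (L * s)))
    have e : Real.exp (L * s) ^ 2 * (‖(x : Plane) - y‖ ^ 2 * Real.exp (-2 * L * (s - 0))) =
        ‖(x : Plane) - y‖ ^ 2 := by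
      rw [mul_left_comm, ← Real.exp_nat_mul, ← Real.exp_add]
      ring_nf
      simp
    rw [mul_pow]
    linarith
  rw [Subtype.dist_eq, dist_eq_norm, Real.dist_eq]
  change _ ≤ Real.exp (L * s) * K * _
  rw [mul_assoc]
  exact h3.trans (mul_le_mul_of_nonneg_left h2 (Real.exp_pos _).le)

lemma exists_mem_trappedSet {v : Plane → Plane} {c : Plane} {δ t₁ : ℝ} {ξ : ℝ → Plane}
    (hξ : IsSolution v ⊤ ξ) (h : ∀ t, t₁ ≤ t → ‖ξ t - c‖ < δ) :
    ∃ n : ℕ, ξ 0 ∈ trappedSet v c δ n n := by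
  obtain ⟨i, hi⟩ := exists_nat_ge t₁
  obtain ⟨R, hR⟩ := hξ.exists_norm_le
    (b := i) (by rw [timeInterval_top]; exact Nat.cast_nonneg (α := ℝ) i)
  obtain ⟨n, hn⟩ := exists_nat_ge (max (i : ℝ) (max R (‖c‖ + δ)))
  obtain ⟨hn1, hn2⟩ := max_le_iff.1 hn
  obtain ⟨hn2, hn3⟩ := max_le_iff.1 hn2
  refine ⟨n, ξ, hξ, rfl, fun t ht => ?_, fun t ht => h t (hi.trans (hn1.trans ht))⟩
  rcases le_total t i with hti | hti
  · exact (hR t ⟨ht.1, hti⟩).trans hn2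
  · have h1 := h t (hi.trans hti)
    have h2 := norm_le_norm_add_norm_sub' (ξ t) c
    linarith

lemma isSolution_const {v : Plane → Plane} {c : Plane} (hc : v c = 0) (T : EReal) :
    IsSolution v T fun _ => c := fun t _ => by
  simpa [hc] using hasDerivWithinAt_const t (timeInterval T) c

end GuidingField

theorem mainTheorem4
    (φ : GuidingField.Plane → ℝ) (hφ : ContDiff ℝ 2 φ)
    (ψ : ℝ → ℝ) (hψ : ContDiff ℝ 1 ψ) (hψmono : StrictMono ψ) (hψ0 : ψ 0 = 0)
    (hψsup : BddAbove (Set.range (deriv ψ)))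
    (k : ℝ) (hk : 0 < k)
    (hpath : GuidingField.BoundedAwayFromZeroOff
      (GuidingField.trackingError φ ψ) (GuidingField.path φ))
    (hsep : GuidingField.PositiveDistance (GuidingField.criticalSet φ) (GuidingField.path φ))
    (hcrit : GuidingField.BoundedAwayFromZeroOff (gradient φ) (GuidingField.criticalSet φ))
    (hfin : (GuidingField.criticalSet φ).Finite)
    (hneg : ∀ c ∈ GuidingField.criticalSet φ, GuidingField.HasNegativeEigenvalue
      (GuidingField.trackingError φ ψ c • GuidingField.hessian φ c)) :
    (∀ᵐ ξ₀ : GuidingField.Plane ∂MeasureTheory.volume,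
      GuidingField.MaximalSolutionConverges (GuidingField.field φ ψ k)
        (GuidingField.path φ) ξ₀) ∧
    ((∀ c ∈ GuidingField.criticalSet φ,
        (-(GuidingField.trackingError φ ψ c • GuidingField.hessian φ c)).PosDef) →
      ∀ ξ₀ : GuidingField.Plane, ξ₀ ∉ GuidingField.criticalSet φ →
        GuidingField.MaximalSolutionConverges (GuidingField.field φ ψ k)
          (GuidingField.path φ) ξ₀) := by
  open GuidingField in
  have hv : ContDiff ℝ 1 (field φ ψ k) := contDiff_field hφ hψ
  have he : ∀ c ∈ criticalSet φ, trackingError φ ψ c ≠ 0 := fun c hc => by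
    refine apply_ne_zero hψmono hψ0 fun h0 => ?_
    obtain ⟨d, hd, hdist⟩ := hsep
    have := hdist c hc c h0
    rw [dist_self] at this
    linarith
  have hloc := fun c : criticalSet φ =>
    exists_controlling_coordinate hφ hψ hk c.2 (he c c.2) (hneg c c.2)
  choose δ hδ K l hK hl using hloc
  have : Finite (criticalSet φ) := hfin
  obtain ⟨d, hd, hd0⟩ : ∃ d, (∀ c, d ≤ δ c) ∧ 0 < d :=
    ((Filter.eventually_all.2 fun c => Filter.mem_of_superset (Ioc_mem_nhdsGT (hδ c))
      fun x hx => hx.2).and (self_mem_nhdsWithin (s := Set.Ioi (0 : ℝ)))).exists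
  have hbad : ∀ x, ¬ MaximalSolutionConverges (field φ ψ k) (path φ) x →
      ∃ (c : criticalSet φ) (ξ : ℝ → Plane) (t₁ : ℝ), IsSolution (field φ ψ k) ⊤ ξ ∧ ξ 0 = x ∧
        0 ≤ t₁ ∧ ∀ t, t₁ ≤ t → ‖ξ t - c‖ < δ c := fun x hx => by
    rw [MaximalSolutionConverges, not_and] at hx
    have h := hx (exists_isMaximalSolution hv x)
    push Not at h
    obtain ⟨T, ξ, hξ, hξ0, hnot⟩ := h
    rcases convergesTo_or_near_criticalSet hφ hψ hψmono hψ0 hk hpath hcrit hfin hξ with h | h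
    · exact absurd h hnot
    · obtain ⟨rfl, h⟩ := h
      obtain ⟨c, hc, t₁, ht₁, hnear⟩ := h d hd0
      exact ⟨⟨c, hc⟩, ξ, t₁, hξ.2.1, hξ0, ht₁, fun t ht => (hnear t ht).trans_le (hd ⟨c, hc⟩)⟩
  refine ⟨?_, fun hdef ξ₀ hξ₀ => ?_⟩
  · rw [MeasureTheory.ae_iff]
    refine MeasureTheory.measure_mono_null (t := ⋃ (c : criticalSet φ) (n : ℕ),
      trappedSet (field φ ψ k) c (δ c) n n) (fun x hx => ?_) ?_
    · obtain ⟨c, ξ, t₁, hξ, rfl, -, hnear⟩ := hbad x hx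
      obtain ⟨n, hn⟩ := exists_mem_trappedSet hξ hnear
      exact Set.mem_iUnion₂.2 ⟨c, n, hn⟩
    · simp only [MeasureTheory.measure_iUnion_null_iff]
      exact fun c n => volume_trappedSet hv n.cast_nonneg
        fun ξ η hξ hη h h' => hl c ξ η hξ hη n n.cast_nonneg h h'
  · by_contra hx
    obtain ⟨c, ξ, t₁, hξ, rfl, ht₁, hnear⟩ := hbad ξ₀ hx
    have hconst := isSolution_const (field_eq_zero (ψ := ψ) (k := k) c.2) ⊤
    have h := hl c ξ _ hξ hconst t₁ ht₁ hnear fun t _ => by simpa using hδ c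
    rw [hK c (hdef c c.2)] at h
    have heq : ξ t₁ = c := by simpa [sub_eq_zero] using h
    have htI : t₁ ∈ timeInterval ⊤ := by rwa [timeInterval_top]
    have h0 : ξ 0 = c := hξ.eq_zero_of_eq hv hconst htI htI heq
    exact hξ₀ (h0 ▸ c.2)
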